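/- For an integer $n\ge 0$, let $s(n,k)$ denote the (signed) Stirling numbers of the first kind, defined by $$z(z-1)\cdots(z-n+1)=\sum_{k=0}^{n}s(n,k)\,z^{k}.$$ Let $H_n=\sum_{i=1}^n \frac1i$ (with $H_0=0$), and for integers $r\ge 1$, $n\ge 0$ let $$h_n^{(r)}=\binom{n+r-1}{r-1}\left(H_{n+r-1}-H_{r-1}\right)$$ be the hyperharmonic numbers. For integers $n\ge 0$ and $r\ge 1$ let $$S(-n,r)=\frac{(-1)^r}{r!}\sum_{j=1}^{r}\binom{r}{j}\frac{(-1)^j}{j^{n}}$$ be the Stirling numbers of the second kind with nonpositive first argument (so in particular $S(0,r)=(-1)^{r+1}/r!$). Let $\zeta$ be the Riemann zeta function. Then for all integers $r\ge 1$ and $m\ge 0$ the following series converges (absolutely), and $$\sum_{n=m}^{\infty}\frac{(-1)^{n-m}s(n,m)\,h_n^{(r)}}{(n+r)!}=(-1)^{r+1}\sum_{k=1}^{m}S(k-m,r)\,\zeta(k+1),$$ where for $m=0$ both sides are $0$. -/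

import Mathlib

/-- The (signed) Stirling number of the first kind `s(n,k)`: the coefficient of `z^k` in the
falling factorial `z (z - 1) ⋯ (z - n + 1)`. -/
noncomputable def signedStirlingFirst (n k : ℕ) : ℤ :=
  (descPochhammer ℤ n).coeff k

/-- The hyperharmonic number `h_n^{(r)} = C(n+r-1, r-1) (H_{n+r-1} - H_{r-1})`, for `r ≥ 1`
(the value at `r = 0` carries no meaning). -/
def hyperharmonic (r n : ℕ) : ℚ :=
  ((n + r - 1).choose (r - 1) : ℚ) * (harmonic (n + r - 1) - harmonic (r - 1))

/-- The Stirling number of the second kind `S(a, r)` with nonpositive integer argument `a = -n`,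
`S(-n, r) = ((-1)^r / r!) ∑_{j=1}^r C(r,j) (-1)^j / j^n`; here `1 / j^n` is written `j^a`. -/
def stirlingSecondInt (a : ℤ) (r : ℕ) : ℚ :=
  (-1) ^ r / (r.factorial : ℚ) *
    ∑ j ∈ Finset.Icc 1 r, (r.choose j : ℚ) * (-1) ^ j * (j : ℚ) ^ a

open Filter Topology

/-! Put r = ρ + 1 and let L(m,n) be the unsigned Stirling number over n! (`logPowCoeff`). The signs
cancel, and the series becomes 1/ρ! times T(ρ,m) = ∑ L(m,n) b_n with b_n = (H_{n+ρ} - H_ρ)/(n+ρ+1).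

The Stirling recurrence gives the Abel summation ∑ L(m,n) b_n = ∑ (n+1) L(m+1,n+1) (b_n - b_{n+1}).
For this b it yields (ρ+2) T(ρ+1,m+1) = (ρ+1) T(ρ,m+1) + T(ρ+1,m) and T(0,m+1) = T(0,m) + ζ(m+2).
The closed form `zetaCombination` obeys the same relations, by the recurrence of S(a,r)
(`stirlingSecondInt_succ`), so induction on m and ρ gives `tendsto_sum_logPowCoeff_mul_harmonic`.
All terms are nonnegative, so convergence of partial sums is enough.

The zeta value enters through ∑ L(m+1,n)/n = ζ(m+2) (`tsum_logPowCoeff_div`). -/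

theorem signedStirlingFirst_eq (n k : ℕ) :
    signedStirlingFirst n k = (-1) ^ (n + k) * (Nat.stirlingFirst n k : ℤ) := by
  induction n generalizing k with
  | zero =>
    cases k with
    | zero => simp [signedStirlingFirst]
    | succ k => simp [signedStirlingFirst, Polynomial.coeff_one]
  | succ n ih =>
    have h : descPochhammer ℤ (n + 1) =
        descPochhammer ℤ n * Polynomial.X - Polynomial.C (n : ℤ) * descPochhammer ℤ n := by
      rw [descPochhammer_succ_right]
      simp only [map_natCast]
      ring
    unfold signedStirlingFirst at ih ⊢
    rw [h, Polynomial.coeff_sub, Polynomial.coeff_C_mul, ih]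
    cases k with
    | zero =>
      rcases n with _ | n <;> simp
    | succ k =>
      rw [Polynomial.coeff_mul_X, ih, Nat.stirlingFirst_succ_succ]
      push_cast
      ring

/-! ### Normalized Stirling numbers and harmonic bounds -/

/-- The coefficient of `x ^ n` in `(-log (1 - x)) ^ m / m!`. -/
noncomputable def logPowCoeff (m n : ℕ) : ℝ :=
  (Nat.stirlingFirst n m : ℝ) / (n.factorial : ℝ)

theorem logPowCoeff_nonneg (m n : ℕ) : 0 ≤ logPowCoeff m n := by
  unfold logPowCoeff; positivity

theorem logPowCoeff_zero_zero : logPowCoeff 0 0 = 1 := by simp [logPowCoeff]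

theorem logPowCoeff_zero_succ (n : ℕ) : logPowCoeff 0 (n + 1) = 0 := by simp [logPowCoeff]

theorem logPowCoeff_succ_zero (m : ℕ) : logPowCoeff (m + 1) 0 = 0 := by simp [logPowCoeff]

theorem succ_mul_logPowCoeff_succ (m n : ℕ) :
    ((n : ℝ) + 1) * logPowCoeff (m + 1) (n + 1) =
      n * logPowCoeff (m + 1) n + logPowCoeff m n := by
  have h1 : (n.factorial : ℝ) ≠ 0 := by positivity
  have h2 : (n : ℝ) + 1 ≠ 0 := by positivity
  unfold logPowCoeff
  rw [Nat.stirlingFirst_succ_succ, Nat.factorial_succ]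
  push_cast
  field_simp

theorem harmonic_cast_succ (n : ℕ) :
    (harmonic (n + 1) : ℝ) = (harmonic n : ℝ) + 1 / ((n : ℝ) + 1) := by
  rw [harmonic_succ]; push_cast; rw [one_div]

theorem harmonic_cast_nonneg (n : ℕ) : 0 ≤ (harmonic n : ℝ) := by
  induction n with
  | zero => simp
  | succ n ih => rw [harmonic_cast_succ]; positivity

theorem monotone_harmonic : Monotone harmonic :=
  monotone_nat_of_le_succ fun n => by
    rw [harmonic_succ]
    exact le_add_of_nonneg_right (by positivity)

/-- The left side is the elementary symmetric polynomial e_m(1, 1/2, ..., 1/n), whose monomials all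
occur in the expansion of H_n^m. -/
theorem succ_mul_logPowCoeff_le (m n : ℕ) :
    ((n : ℝ) + 1) * logPowCoeff (m + 1) (n + 1) ≤ (harmonic n : ℝ) ^ m := by
  induction n generalizing m with
  | zero =>
    cases m with
    | zero => simp [logPowCoeff, Nat.stirlingFirst]
    | succ m => simp [logPowCoeff, Nat.stirlingFirst]
  | succ n ih =>
    rw [succ_mul_logPowCoeff_succ]
    have h0 := harmonic_cast_nonneg n
    have hp : (0 : ℝ) < (n : ℝ) + 1 := by positivity
    cases m with
    | zero =>
      have := ih 0
      rw [logPowCoeff_zero_succ]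
      push_cast
      simpa using this
    | succ m =>
      have h1 := ih (m + 1)
      have h2 : logPowCoeff (m + 1) (n + 1) ≤ (harmonic n : ℝ) ^ m / ((n : ℝ) + 1) := by
        rw [le_div_iff₀ hp, mul_comm]; exact ih m
      push_cast
      calc _ ≤ (harmonic n : ℝ) ^ (m + 1) + (harmonic n : ℝ) ^ m / ((n : ℝ) + 1) :=
            add_le_add h1 h2
        _ = (harmonic n : ℝ) ^ m * (harmonic (n + 1) : ℝ) := by
            rw [harmonic_cast_succ]; ring
        _ ≤ (harmonic (n + 1) : ℝ) ^ m * (harmonic (n + 1) : ℝ) := by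
            gcongr
            · exact harmonic_cast_nonneg _
            · exact monotone_harmonic n.le_succ
        _ = _ := by ring

theorem tendsto_harmonic_pow_div (k : ℕ) :
    Tendsto (fun n : ℕ => (harmonic n : ℝ) ^ k / ((n : ℝ) + 1)) atTop (𝓝 0) := by
  have h1 : Tendsto (fun x : ℝ => Real.log x ^ k / x) atTop (𝓝 0) :=
    (Real.isLittleO_pow_log_id_atTop (n := k)).tendsto_div_nhds_zero
  have h2 : Tendsto (fun n : ℕ => Real.exp 1 * (n : ℝ)) atTop atTop :=
    tendsto_natCast_atTop_atTop.const_mul_atTop (Real.exp_pos 1)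
  -- The factor e turns the bound H_n ≤ 1 + log n into H_n ≤ log (e n).
  have h3 := (h1.comp h2).const_mul (Real.exp 1)
  rw [mul_zero] at h3
  refine squeeze_zero' (Eventually.of_forall fun n => ?_) ?_ h3
  · have := harmonic_cast_nonneg n
    positivity
  · filter_upwards [eventually_gt_atTop 0] with n hn
    have hn' : (0 : ℝ) < n := by exact_mod_cast hn
    have hl : (harmonic n : ℝ) ≤ Real.log (Real.exp 1 * n) := by
      rw [Real.log_mul (Real.exp_pos 1).ne' hn'.ne', Real.log_exp]
      exact harmonic_le_one_add_log n
    have h0 := harmonic_cast_nonneg n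
    have he := Real.exp_pos 1
    calc (harmonic n : ℝ) ^ k / ((n : ℝ) + 1)
        ≤ Real.log (Real.exp 1 * n) ^ k / n := by
          gcongr
          · exact pow_nonneg (h0.trans hl) _
          · linarith
      _ = _ := by
          simp only [Function.comp]
          field_simp

theorem summable_harmonic_pow_div (k : ℕ) :
    Summable fun n : ℕ => (harmonic n : ℝ) ^ k / ((n : ℝ) + 1) ^ 2 := by
  have hs : Summable fun n : ℕ => 1 / ((n : ℝ) + 1) ^ (3 / 2 : ℝ) := by
    have := (summable_nat_add_iff 1).2 (Real.summable_one_div_nat_rpow.2 (by norm_num : (1 : ℝ) < 3 / 2))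
    simpa using this
  -- Exponent 2k gives H_n^k ≤ (n+1)^(1/2) eventually, hence comparison with (n+1)^(-3/2).
  have ht := tendsto_harmonic_pow_div (2 * k)
  have hev := ht.eventually (gt_mem_nhds (zero_lt_one))
  refine summable_of_isBigO_nat hs (Asymptotics.IsBigO.of_bound 1 ?_)
  filter_upwards [hev] with n hn
  have hp : (0 : ℝ) < (n : ℝ) + 1 := by positivity
  have h0 := harmonic_cast_nonneg n
  rw [div_lt_one hp] at hn
  have h1 : (harmonic n : ℝ) ^ k ≤ ((n : ℝ) + 1) ^ (1 / 2 : ℝ) := by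
    rw [← Real.sqrt_eq_rpow]
    refine Real.le_sqrt_of_sq_le ?_
    rw [← pow_mul, mul_comm k 2]
    exact hn.le
  rw [Real.norm_of_nonneg (by positivity), Real.norm_of_nonneg (by positivity), one_mul,
    div_le_div_iff₀ (by positivity) (by positivity), one_mul]
  calc (harmonic n : ℝ) ^ k * ((n : ℝ) + 1) ^ (3 / 2 : ℝ)
      ≤ ((n : ℝ) + 1) ^ (1 / 2 : ℝ) * ((n : ℝ) + 1) ^ (3 / 2 : ℝ) := by gcongr
    _ = _ := by
      rw [← Real.rpow_add hp, ← Real.rpow_natCast]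
      norm_num

/-! ### Abel summation and its boundary term -/

/-- Abel summation against `logPowCoeff`, from the recurrence `succ_mul_logPowCoeff_succ`. -/
theorem sum_logPowCoeff_mul (m : ℕ) (b : ℕ → ℝ) (N : ℕ) :
    ∑ n ∈ Finset.range N, logPowCoeff m n * b n =
      N * logPowCoeff (m + 1) N * b N +
        ∑ n ∈ Finset.range N, ((n : ℝ) + 1) * logPowCoeff (m + 1) (n + 1) * (b n - b (n + 1)) := by
  induction N with
  | zero => simp
  | succ N ih =>
    rw [Finset.sum_range_succ, ih, Finset.sum_range_succ]
    have := succ_mul_logPowCoeff_succ m N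
    push_cast
    linear_combination (-b N) * this

theorem tendsto_sum_logPowCoeff_mul_sub {m : ℕ} {b : ℕ → ℝ} {s : ℝ}
    (hs : Tendsto (fun N => ∑ n ∈ Finset.range N, logPowCoeff m n * b n) atTop (𝓝 s))
    (hb : Tendsto (fun N : ℕ => N * logPowCoeff (m + 1) N * b N) atTop (𝓝 0)) :
    Tendsto (fun N => ∑ n ∈ Finset.range N,
      ((n : ℝ) + 1) * logPowCoeff (m + 1) (n + 1) * (b n - b (n + 1))) atTop (𝓝 s) := by
  have := hs.sub hb
  rw [sub_zero] at this
  refine this.congr fun N => ?_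
  rw [sum_logPowCoeff_mul]
  ring

theorem tendsto_boundary {m k : ℕ} {b : ℕ → ℝ} (c : ℕ) (hb0 : ∀ n, 0 ≤ b n)
    (hb : ∀ n, b n ≤ (harmonic (n + c) : ℝ) ^ k / ((n : ℝ) + c + 1)) :
    Tendsto (fun N : ℕ => N * logPowCoeff (m + 1) N * b N) atTop (𝓝 0) := by
  have h := (tendsto_harmonic_pow_div (m + k)).comp (tendsto_add_atTop_nat c)
  refine squeeze_zero (fun N => ?_) (fun N => ?_) h
  · have := logPowCoeff_nonneg (m + 1) N
    have := hb0 N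
    positivity
  · have h1 : N * logPowCoeff (m + 1) N ≤ (harmonic (N + c) : ℝ) ^ m := by
      cases N with
      | zero =>
        have := harmonic_cast_nonneg (0 + c)
        simp only [Nat.cast_zero, zero_mul]
        positivity
      | succ N =>
        have := succ_mul_logPowCoeff_le m N
        push_cast
        refine this.trans ?_
        gcongr
        · exact harmonic_cast_nonneg _
        · exact monotone_harmonic (by omega)
    have h2 := harmonic_cast_nonneg (N + c)
    calc _ ≤ (harmonic (N + c) : ℝ) ^ m * ((harmonic (N + c) : ℝ) ^ k / ((N : ℝ) + c + 1)) :=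
          mul_le_mul h1 (hb N) (hb0 N) (by positivity)
      _ = _ := by
          simp only [Function.comp]
          push_cast
          ring

/-! ### Zeta values as Stirling series -/

theorem succ_le_choose_add (n q : ℕ) : n + 1 ≤ (n + (q + 1)).choose n := by
  calc n + 1 = (n + 1).choose n := by simp
    _ ≤ _ := Nat.choose_le_choose n (by omega)

/-- For b_n = 1/C(n+q+1,n) one has (n+1)(b_n - b_{n+1}) = (q+1) b_{n+1}, so each Abel summation
raises m by one and costs a factor 1/(q+1). -/
theorem tendsto_sum_logPowCoeff_div_choose (m q : ℕ) :
    Tendsto (fun N => ∑ n ∈ Finset.range N,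
      logPowCoeff m n * (1 / ((n + (q + 1)).choose n : ℝ))) atTop
      (𝓝 (1 / ((q : ℝ) + 1) ^ m)) := by
  induction m with
  | zero =>
    refine tendsto_atTop_of_eventually_const (i₀ := 1) fun N hN => ?_
    obtain ⟨N, rfl⟩ := Nat.exists_eq_add_of_le' hN
    rw [Finset.sum_range_succ']
    simp [logPowCoeff_zero_succ, logPowCoeff_zero_zero]
  | succ m ih =>
    have hb := tendsto_boundary (m := m) (k := 0) (b := fun n => 1 / ((n + (q + 1)).choose n : ℝ)) 0
      (fun n => by positivity) (fun n => by
        have : ((n + 1 : ℕ) : ℝ) ≤ ((n + (q + 1)).choose n : ℝ) := by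
          exact_mod_cast succ_le_choose_add n q
        push_cast at this
        rw [pow_zero, Nat.cast_zero, add_zero]
        gcongr)
    have h := (tendsto_sum_logPowCoeff_mul_sub ih hb).const_mul (1 / ((q : ℝ) + 1))
    rw [← tendsto_add_atTop_iff_nat 1]
    have e : 1 / ((q : ℝ) + 1) * (1 / ((q : ℝ) + 1) ^ m) = 1 / ((q : ℝ) + 1) ^ (m + 1) := by
      rw [pow_succ]; field_simp
    rw [e] at h
    refine h.congr fun N => ?_
    rw [Finset.sum_range_succ', logPowCoeff_succ_zero, zero_mul, add_zero, Finset.mul_sum]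
    refine Finset.sum_congr rfl fun n _ => ?_
    have hc : ((n + (q + 1)).choose n : ℝ) * ((n : ℝ) + q + 2) =
        ((n + 1 + (q + 1)).choose (n + 1) : ℝ) * ((n : ℝ) + 1) := by
      have := Nat.add_one_mul_choose_eq (n + (q + 1)) n
      rw [show n + 1 + (q + 1) = n + (q + 1) + 1 by ring]
      have h' : ((n + (q + 1) + 1 : ℕ) : ℝ) * ((n + (q + 1)).choose n : ℝ) =
        ((n + (q + 1) + 1).choose (n + 1) : ℝ) * ((n + 1 : ℕ) : ℝ) := by exact_mod_cast this
      push_cast at h'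
      linear_combination h'
    have p1 : ((n + (q + 1)).choose n : ℝ) ≠ 0 := by
      exact_mod_cast (Nat.choose_pos (by omega)).ne'
    have p2 : ((n + 1 + (q + 1)).choose (n + 1) : ℝ) ≠ 0 := by
      exact_mod_cast (Nat.choose_pos (by omega)).ne'
    field_simp
    linear_combination (-logPowCoeff (m + 1) (n + 1)) * hc

theorem hasSum_logPowCoeff_div_choose (m q : ℕ) :
    HasSum (fun n : ℕ => logPowCoeff (m + 1) (n + 1) * (1 / ((n + 1 + (q + 1)).choose (n + 1) : ℝ)))
      (1 / ((q : ℝ) + 1) ^ (m + 1)) := by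
  rw [hasSum_iff_tendsto_nat_of_nonneg fun n =>
    mul_nonneg (logPowCoeff_nonneg _ _) (by positivity)]
  have h := tendsto_sum_logPowCoeff_div_choose (m + 1) q
  rw [← tendsto_add_atTop_iff_nat 1] at h
  refine h.congr fun N => ?_
  rw [Finset.sum_range_succ', logPowCoeff_succ_zero, zero_mul, add_zero]

theorem summable_logPowCoeff_div (m : ℕ) :
    Summable fun n : ℕ => logPowCoeff (m + 1) (n + 1) / ((n : ℝ) + 1) := by
  refine Summable.of_nonneg_of_le (fun n => ?_) (fun n => ?_) (summable_harmonic_pow_div m)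
  · have := logPowCoeff_nonneg (m + 1) (n + 1)
    positivity
  · have := succ_mul_logPowCoeff_le m n
    rw [div_le_div_iff₀ (by positivity) (by positivity)]
    have hp : (0 : ℝ) < (n : ℝ) + 1 := by positivity
    nlinarith

/-- Weighting the terms by 1/C(n+1+q,n+1) gives sums that telescope in q: the value at q = 0 is the
left side, the limit is 0, and consecutive differences are 1/(q+1)^(m+2). -/
theorem tsum_logPowCoeff_div (m : ℕ) :
    ∑' n : ℕ, logPowCoeff (m + 1) (n + 1) / ((n : ℝ) + 1) =
      ∑' q : ℕ, 1 / ((q : ℝ) + 1) ^ (m + 2) := by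
  set κ : ℕ → ℕ → ℝ := fun q n =>
    logPowCoeff (m + 1) (n + 1) / ((n : ℝ) + 1) * (1 / ((n + 1 + q).choose (n + 1) : ℝ)) with hκ
  have hS := summable_logPowCoeff_div m
  have hnn : ∀ n : ℕ, 0 ≤ logPowCoeff (m + 1) (n + 1) / ((n : ℝ) + 1) := fun n => by
    have := logPowCoeff_nonneg (m + 1) (n + 1)
    positivity
  have hle : ∀ q n, κ q n ≤ logPowCoeff (m + 1) (n + 1) / ((n : ℝ) + 1) * (1 / ((q : ℝ) + 1)) := by
    intro q n
    refine mul_le_mul_of_nonneg_left ?_ (hnn n)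
    have : q + 1 ≤ (n + 1 + q).choose (n + 1) := by
      rw [Nat.choose_symm_add]
      calc q + 1 = (q + 1).choose q := by simp
        _ ≤ _ := Nat.choose_le_choose q (by omega)
    have : ((q + 1 : ℕ) : ℝ) ≤ ((n + 1 + q).choose (n + 1) : ℝ) := by exact_mod_cast this
    push_cast at this
    gcongr
  have hκ0 : ∀ q n, 0 ≤ κ q n := fun q n => mul_nonneg (hnn n) (by positivity)
  have hκS : ∀ q, Summable (κ q) := fun q =>
    Summable.of_nonneg_of_le (hκ0 q) (hle q) (hS.mul_right _)
  have hdiff : ∀ q : ℕ, (∑' n, κ q n) - ∑' n, κ (q + 1) n = 1 / ((q : ℝ) + 1) ^ (m + 2) := by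
    intro q
    rw [← (hκS q).tsum_sub (hκS (q + 1))]
    have h := (hasSum_logPowCoeff_div_choose m q).mul_left (1 / ((q : ℝ) + 1))
    have e : 1 / ((q : ℝ) + 1) * (1 / ((q : ℝ) + 1) ^ (m + 1)) = 1 / ((q : ℝ) + 1) ^ (m + 2) := by
      rw [pow_succ _ (m + 1)]; field_simp
    rw [← e, ← h.tsum_eq]
    refine tsum_congr fun n => ?_
    have hc : ((n + 1 + q).choose (n + 1) : ℝ) * ((n : ℝ) + q + 2) =
        ((n + 1 + (q + 1)).choose (n + 1) : ℝ) * ((q : ℝ) + 1) := by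
      have h1 := Nat.add_one_mul_choose_eq (n + 1 + q) q
      rw [Nat.choose_symm_add, Nat.choose_symm_add]
      have h' : ((n + 1 + q + 1 : ℕ) : ℝ) * ((n + 1 + q).choose q : ℝ) =
        ((n + 1 + q + 1).choose (q + 1) : ℝ) * ((q + 1 : ℕ) : ℝ) := by exact_mod_cast h1
      push_cast at h'
      rw [show n + 1 + (q + 1) = n + 1 + q + 1 by ring]
      linear_combination h'
    have p1 : ((n + 1 + q).choose (n + 1) : ℝ) ≠ 0 := by
      exact_mod_cast (Nat.choose_pos (by omega)).ne'
    have p2 : ((n + 1 + (q + 1)).choose (n + 1) : ℝ) ≠ 0 := by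
      exact_mod_cast (Nat.choose_pos (by omega)).ne'
    simp only [hκ]
    field_simp
    linear_combination (-logPowCoeff (m + 1) (n + 1)) * hc
  have hlim : Tendsto (fun q => ∑' n, κ q n) atTop (𝓝 0) := by
    refine squeeze_zero (fun q => tsum_nonneg (hκ0 q))
      (fun q => (hκS q).tsum_le_tsum (hle q) (hS.mul_right _)) ?_
    simp_rw [tsum_mul_right]
    simpa using tendsto_one_div_add_atTop_nhds_zero_nat.const_mul
      (∑' n : ℕ, logPowCoeff (m + 1) (n + 1) / ((n : ℝ) + 1))
  have hT : HasSum (fun q : ℕ => 1 / ((q : ℝ) + 1) ^ (m + 2)) (∑' n, κ 0 n) := by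
    rw [hasSum_iff_tendsto_nat_of_nonneg fun q => by positivity]
    have := hlim.const_sub (∑' n, κ 0 n)
    rw [sub_zero] at this
    refine this.congr fun Q => ?_
    rw [← Finset.sum_range_sub' (fun q => ∑' n, κ q n)]
    exact Finset.sum_congr rfl fun q _ => hdiff q
  rw [hT.tsum_eq]
  simp [hκ]

theorem riemannZeta_nat_add_two (k : ℕ) :
    riemannZeta ((k : ℂ) + 2) = ((∑' q : ℕ, 1 / ((q : ℝ) + 1) ^ (k + 2) : ℝ) : ℂ) := by
  have h := zeta_eq_tsum_one_div_nat_add_one_cpow (s := (k : ℂ) + 2) (by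
    simp only [Complex.add_re, Complex.natCast_re, Complex.re_ofNat]
    linarith [(Nat.cast_nonneg k : (0 : ℝ) ≤ k)])
  rw [h, Complex.ofReal_tsum]
  refine tsum_congr fun q => ?_
  push_cast
  rw [← Complex.cpow_natCast]
  push_cast
  rfl

/-! ### Recurrence for S(a,r) and the closed form -/

theorem stirlingSecondInt_one (a : ℤ) : stirlingSecondInt a 1 = 1 := by
  simp [stirlingSecondInt]

theorem stirlingSecondInt_succ (a : ℤ) (r : ℕ) :
    stirlingSecondInt (a + 1) (r + 1) =
      (r + 1) * stirlingSecondInt a (r + 1) + stirlingSecondInt a r := by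
  have key : ∑ j ∈ Finset.Icc 1 (r + 1), ((r + 1).choose j : ℚ) * (-1) ^ j * (j : ℚ) ^ (a + 1) -
      (r + 1) * ∑ j ∈ Finset.Icc 1 (r + 1), ((r + 1).choose j : ℚ) * (-1) ^ j * (j : ℚ) ^ a =
      -(r + 1) * ∑ j ∈ Finset.Icc 1 r, (r.choose j : ℚ) * (-1) ^ j * (j : ℚ) ^ a := by
    have hlast : ∑ j ∈ Finset.Icc 1 r, (r.choose j : ℚ) * (-1) ^ j * (j : ℚ) ^ a =
        ∑ j ∈ Finset.Icc 1 (r + 1), (r.choose j : ℚ) * (-1) ^ j * (j : ℚ) ^ a := by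
      rw [Finset.sum_Icc_succ_top (by omega)]
      simp
    rw [hlast, Finset.mul_sum, Finset.mul_sum, ← Finset.sum_sub_distrib]
    refine Finset.sum_congr rfl fun j hj => ?_
    obtain ⟨h1, h2⟩ := Finset.mem_Icc.1 hj
    have hj0 : (j : ℚ) ≠ 0 := by exact_mod_cast (by omega : j ≠ 0)
    have hc : ((r + 1).choose j : ℚ) * ((r : ℚ) + 1 - j) = (r + 1) * (r.choose j : ℚ) := by
      have := Nat.choose_mul_succ_eq r j
      have h' : (r.choose j : ℚ) * ((r + 1 : ℕ) : ℚ) =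
        ((r + 1).choose j : ℚ) * ((r + 1 - j : ℕ) : ℚ) := by exact_mod_cast this
      rw [Nat.cast_sub h2] at h'
      push_cast at h'
      linear_combination -h'
    rw [zpow_add_one₀ hj0]
    linear_combination (-(-1) ^ j * (j : ℚ) ^ a) * hc
  have hf : (r.factorial : ℚ) ≠ 0 := by positivity
  have hr : (r : ℚ) + 1 ≠ 0 := by positivity
  unfold stirlingSecondInt
  rw [Nat.factorial_succ]
  push_cast
  field_simp
  rw [pow_succ]
  linear_combination (-(-1) ^ r) * key

/-- This vanishing lets the sum in `zetaCombination (ρ + 1) m` be extended by the term k = m, to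
match the range for m + 1. -/
theorem stirlingSecondInt_one_left (r : ℕ) : stirlingSecondInt 1 (r + 2) = 0 := by
  have h0 : ∀ r : ℕ, stirlingSecondInt 0 (r + 1) = (-1) ^ r / ((r + 1).factorial : ℚ) := by
    intro r
    have h := Int.alternating_sum_range_choose (n := r + 1)
    rw [if_neg (by omega), Finset.sum_range_eq_add_Ico _ (by omega)] at h
    have hI : Finset.Ico 1 (r + 1 + 1) = Finset.Icc 1 (r + 1) := by ext; simp
    rw [hI] at h
    have h' : ((1 : ℚ) + ∑ j ∈ Finset.Icc 1 (r + 1), (-1 : ℚ) ^ j * ((r + 1).choose j : ℚ)) = 0 := by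
      have := congrArg (Int.cast : ℤ → ℚ) h
      push_cast at this
      simpa using this
    unfold stirlingSecondInt
    simp only [zpow_zero, mul_one]
    have h2 : ∑ j ∈ Finset.Icc 1 (r + 1), ((r + 1).choose j : ℚ) * (-1 : ℚ) ^ j = -1 := by
      rw [Finset.sum_congr rfl fun j _ => mul_comm ((r + 1).choose j : ℚ) ((-1 : ℚ) ^ j)]
      linarith
    rw [h2, pow_succ]
    ring
  have hs := stirlingSecondInt_succ 0 (r + 1)
  rw [zero_add] at hs
  rw [hs, h0, h0, Nat.factorial_succ (r + 1)]
  have hf : ((r + 1).factorial : ℚ) ≠ 0 := by positivity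
  push_cast
  have hr : (r : ℚ) + 1 + 1 ≠ 0 := by positivity
  field_simp
  ring

/-- The closed form of the sum `∑ n, logPowCoeff m n * (H_{n+ρ} - H_ρ) / (n + ρ + 1)`. -/
noncomputable def zetaCombination (ρ m : ℕ) : ℝ :=
  (ρ.factorial : ℝ) * (-1) ^ ρ * ∑ k ∈ Finset.range m,
    (stirlingSecondInt ((k : ℤ) + 1 - m) (ρ + 1) : ℝ) * ∑' q : ℕ, 1 / ((q : ℝ) + 1) ^ (k + 2)

theorem zetaCombination_zero_right (ρ : ℕ) : zetaCombination ρ 0 = 0 := by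
  simp [zetaCombination]

theorem zetaCombination_zero_succ (m : ℕ) :
    zetaCombination 0 (m + 1) =
      zetaCombination 0 m + ∑' q : ℕ, 1 / ((q : ℝ) + 1) ^ (m + 2) := by
  simp [zetaCombination, stirlingSecondInt_one, Finset.sum_range_succ]

theorem zetaCombination_succ_succ (ρ m : ℕ) :
    ((ρ : ℝ) + 2) * zetaCombination (ρ + 1) (m + 1) =
      (ρ + 1) * zetaCombination ρ (m + 1) + zetaCombination (ρ + 1) m := by
  have h : zetaCombination (ρ + 1) m = ((ρ + 1).factorial : ℝ) * (-1) ^ (ρ + 1) *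
      ∑ k ∈ Finset.range (m + 1), (stirlingSecondInt ((k : ℤ) + 1 - m) (ρ + 2) : ℝ) *
        ∑' q : ℕ, 1 / ((q : ℝ) + 1) ^ (k + 2) := by
    rw [Finset.sum_range_succ, show (m : ℤ) + 1 - m = 1 by ring, stirlingSecondInt_one_left]
    simp [zetaCombination]
  rw [h]
  simp only [zetaCombination, Nat.factorial_succ, Finset.mul_sum, ← Finset.sum_add_distrib]
  refine Finset.sum_congr rfl fun k _ => ?_
  have hs := stirlingSecondInt_succ ((k : ℤ) + 1 - (m + 1 : ℕ)) (ρ + 1)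
  have hs' := congrArg (Rat.cast : ℚ → ℝ) hs
  rw [show (k : ℤ) + 1 - (m + 1 : ℕ) + 1 = (k : ℤ) + 1 - m by push_cast; ring] at hs'
  push_cast at hs' ⊢
  rw [hs']
  ring

/-! ### Evaluation of the series -/

theorem tendsto_sum_logPowCoeff_mul_harmonic (ρ m : ℕ) :
    Tendsto (fun N => ∑ n ∈ Finset.range N, logPowCoeff m n *
      (((harmonic (n + ρ) : ℝ) - (harmonic ρ : ℝ)) / ((n : ℝ) + ρ + 1))) atTop
      (𝓝 (zetaCombination ρ m)) := by
  have hsub : ∀ ρ n : ℕ, 0 ≤ (harmonic (n + ρ) : ℝ) - (harmonic ρ : ℝ) := fun ρ n =>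
    sub_nonneg.2 (by exact_mod_cast monotone_harmonic (Nat.le_add_left ρ n))
  have hbd : ∀ ρ m : ℕ, Tendsto (fun N : ℕ => N * logPowCoeff (m + 1) N *
      (((harmonic (N + ρ) : ℝ) - (harmonic ρ : ℝ)) / ((N : ℝ) + ρ + 1))) atTop (𝓝 0) :=
    fun ρ m => tendsto_boundary (k := 1) ρ
      (fun n => div_nonneg (hsub ρ n) (by positivity)) (fun n => by
        rw [pow_one]
        gcongr
        exact sub_le_self _ (harmonic_cast_nonneg ρ))
  induction m generalizing ρ with
  | zero =>
    rw [zetaCombination_zero_right]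
    refine tendsto_const_nhds.congr fun N => ?_
    refine (Finset.sum_eq_zero fun n _ => ?_).symm
    cases n with
    | zero => simp
    | succ n => rw [logPowCoeff_zero_succ, zero_mul]
  | succ m ihm =>
    induction ρ with
    | zero =>
      have h1 := tendsto_sum_logPowCoeff_mul_sub (ihm 0) (hbd 0 m)
      have h2 := (summable_logPowCoeff_div m).hasSum.tendsto_sum_nat
      rw [tsum_logPowCoeff_div] at h2
      -- Abel summation produces terms at n + 1; shifting N aligns them, since the n = 0 term is
      -- zero.
      rw [zetaCombination_zero_succ, ← tendsto_add_atTop_iff_nat 1]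
      refine (h1.add h2).congr fun N => ?_
      rw [Finset.sum_range_succ', logPowCoeff_succ_zero, zero_mul, add_zero,
        ← Finset.sum_add_distrib]
      refine Finset.sum_congr rfl fun n _ => ?_
      have hn : (n : ℝ) + 1 ≠ 0 := by positivity
      have hn2 : (n : ℝ) + 2 ≠ 0 := by positivity
      have hn3 : (n : ℝ) + 1 + 1 ≠ 0 := by positivity
      simp only [add_zero, harmonic_zero, harmonic_cast_succ]
      push_cast
      field_simp
      ring
    | succ ρ ihρ =>
      have h1 := tendsto_sum_logPowCoeff_mul_sub (ihm (ρ + 1)) (hbd (ρ + 1) m)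
      have h2 := (ihρ.comp (tendsto_add_atTop_nat 1)).const_mul ((ρ : ℝ) + 1)
      have h3 := (h2.add h1).const_mul (1 / ((ρ : ℝ) + 2))
      have hρ : (ρ : ℝ) + 2 ≠ 0 := by positivity
      rw [← zetaCombination_succ_succ, ← mul_assoc, one_div_mul_cancel hρ, one_mul] at h3
      rw [← tendsto_add_atTop_iff_nat 1]
      refine h3.congr fun N => ?_
      simp only [Function.comp]
      rw [Finset.sum_range_succ', Finset.sum_range_succ', logPowCoeff_succ_zero, zero_mul,
        zero_mul, add_zero, add_zero, Finset.mul_sum, ← Finset.sum_add_distrib, Finset.mul_sum]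
      refine Finset.sum_congr rfl fun n _ => ?_
      have e1 : (harmonic (n + 1 + (ρ + 1)) : ℝ) =
          (harmonic (n + ρ) : ℝ) + 1 / ((n : ℝ) + ρ + 1) + 1 / ((n : ℝ) + ρ + 2) := by
        rw [show n + 1 + (ρ + 1) = n + ρ + 1 + 1 by ring, harmonic_cast_succ, harmonic_cast_succ]
        push_cast
        ring
      have e2 : (harmonic (n + (ρ + 1)) : ℝ) =
          (harmonic (n + ρ) : ℝ) + 1 / ((n : ℝ) + ρ + 1) := by
        rw [show n + (ρ + 1) = n + ρ + 1 by ring, harmonic_cast_succ]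
        push_cast
        ring
      have e3 : (harmonic (n + 1 + ρ) : ℝ) =
          (harmonic (n + ρ) : ℝ) + 1 / ((n : ℝ) + ρ + 1) := by
        rw [← e2]; congr 2; ring
      rw [e1, e2, e3, harmonic_cast_succ ρ]
      generalize (harmonic (n + ρ) : ℝ) = x
      generalize (harmonic ρ : ℝ) = y
      push_cast
      have d1 : (n : ℝ) + ρ + 1 ≠ 0 := by positivity
      have d2 : (n : ℝ) + ρ + 2 ≠ 0 := by positivity
      have d3 : (n : ℝ) + ρ + 3 ≠ 0 := by positivity
      have d4 : (ρ : ℝ) + 1 ≠ 0 := by positivity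
      rw [show (n : ℝ) + 1 + ρ + 1 = n + ρ + 2 by ring,
        show (n : ℝ) + (ρ + 1) + 1 = n + ρ + 2 by ring,
        show (n : ℝ) + 1 + (ρ + 1) + 1 = n + ρ + 3 by ring]
      field_simp
      ring

theorem hasSum_logPowCoeff_mul_harmonic (ρ m : ℕ) :
    HasSum (fun n : ℕ => logPowCoeff m n *
      (((harmonic (n + ρ) : ℝ) - (harmonic ρ : ℝ)) / ((n : ℝ) + ρ + 1)))
      (zetaCombination ρ m) := by
  rw [hasSum_iff_tendsto_nat_of_nonneg fun n => ?_]
  · exact tendsto_sum_logPowCoeff_mul_harmonic ρ m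
  · refine mul_nonneg (logPowCoeff_nonneg m n) (div_nonneg (sub_nonneg.2 ?_) (by positivity))
    exact_mod_cast monotone_harmonic (Nat.le_add_left ρ n)

theorem zetaCombination_eq_sum_riemannZeta (ρ m : ℕ) :
    1 / (ρ.factorial : ℂ) * (zetaCombination ρ m : ℂ) =
      (-1 : ℂ) ^ (ρ + 1 + 1) * ∑ k ∈ Finset.Icc 1 m,
        (stirlingSecondInt ((k : ℤ) - (m : ℤ)) (ρ + 1) : ℂ) * riemannZeta ((k : ℂ) + 1) := by
  have hf : (ρ.factorial : ℂ) ≠ 0 := by exact_mod_cast ρ.factorial_ne_zero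
  have hI : Finset.Icc 1 m = Finset.Ico (0 + 1) (m + 1) := by ext; simp
  rw [hI, ← Finset.sum_Ico_add' _ 0 m 1, ← Finset.range_eq_Ico, zetaCombination]
  have hs : ∑ k ∈ Finset.range m, (stirlingSecondInt (((k + 1 : ℕ) : ℤ) - (m : ℤ)) (ρ + 1) : ℂ) *
        riemannZeta (((k + 1 : ℕ) : ℂ) + 1) =
      ((∑ k ∈ Finset.range m, (stirlingSecondInt ((k : ℤ) + 1 - m) (ρ + 1) : ℝ) *
        ∑' q : ℕ, 1 / ((q : ℝ) + 1) ^ (k + 2) : ℝ) : ℂ) := by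
    rw [Complex.ofReal_sum]
    refine Finset.sum_congr rfl fun k _ => ?_
    rw [Complex.ofReal_mul, ← riemannZeta_nat_add_two, Complex.ofReal_ratCast]
    push_cast
    rw [show (k : ℂ) + 1 + 1 = k + 2 by ring]
  rw [hs, Complex.ofReal_mul, Complex.ofReal_mul, Complex.ofReal_natCast]
  push_cast
  field_simp
  ring

theorem mainTheorem10 (r m : ℕ) (hr : 1 ≤ r) :
    HasSum
      (fun i : ℕ =>
        (-1 : ℂ) ^ i * (signedStirlingFirst (m + i) m : ℂ) * (hyperharmonic r (m + i) : ℂ) /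
          ((m + i + r).factorial : ℂ))
      ((-1 : ℂ) ^ (r + 1) *
        ∑ k ∈ Finset.Icc 1 m,
          (stirlingSecondInt ((k : ℤ) - (m : ℤ)) r : ℂ) * riemannZeta ((k : ℂ) + 1)) := by
  obtain ⟨ρ, rfl⟩ := Nat.exists_eq_add_of_le' hr
  have hf : (ρ.factorial : ℂ) ≠ 0 := by exact_mod_cast ρ.factorial_ne_zero
  have h := hasSum_logPowCoeff_mul_harmonic ρ m
  -- Terms with n < m vanish, so the sum may start at n = m.
  rw [← (add_right_injective m).hasSum_iff fun n hn => ?_] at h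
  · have h' := (Complex.hasSum_ofReal.2 h).mul_left (1 / (ρ.factorial : ℂ))
    rw [zetaCombination_eq_sum_riemannZeta] at h'
    refine (congrArg (HasSum · _) (funext fun i => ?_)).mpr h'
    have hn : (((m + i).factorial : ℕ) : ℂ) ≠ 0 := by exact_mod_cast (m + i).factorial_ne_zero
    have hd : ((m + i : ℕ) : ℂ) + ρ + 1 ≠ 0 := by exact_mod_cast (m + i + ρ).succ_ne_zero
    have hc : ((m + i + ρ).choose ρ : ℂ) * (m + i).factorial * ρ.factorial =
        (m + i + ρ).factorial := by
      have := Nat.add_choose_mul_factorial_mul_factorial (m + i) ρ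
      exact_mod_cast this
    have hsgn : (-1 : ℂ) ^ i * (-1) ^ (m + i + m) = 1 := by
      rw [← pow_add, show i + (m + i + m) = 2 * (m + i) by ring, pow_mul]
      simp
    rw [signedStirlingFirst_eq]
    simp only [hyperharmonic, logPowCoeff, Function.comp,
      show ρ + 1 - 1 = ρ by omega, show m + i + (ρ + 1) = m + i + ρ + 1 by ring,
      Nat.factorial_succ (m + i + ρ)]
    push_cast at hd hc ⊢
    have e : ∀ a b c x y z : ℂ, a * (b * c) * (x * y) / z = a * b * (c * x * y / z) := by
      intros; ring
    rw [e, hsgn, one_mul, ← hc]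
    have hch : ((m + i + ρ).choose ρ : ℂ) ≠ 0 := by
      exact_mod_cast (Nat.choose_pos (by omega)).ne'
    field_simp
  · have : n < m := by
      by_contra hlt
      exact hn ⟨n - m, by simp; omega⟩
    simp [logPowCoeff, Nat.stirlingFirst_eq_zero_of_lt this]
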